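/- For a metric space $M$ with a base point $0\in M$, let $\mathrm{Lip}_0(M)$ be the Banach space of Lipschitz functions $f\colon M\to\mathbb R$ with $f(0)=0$, normed by $\|f\|_L=\sup\{\frac{f(x)-f(y)}{d(x,y)}: x\neq y\}$, and let the Lipschitz free space $\mathcal F(M)$ be the norm-closed linear span of the evaluation functionals $\delta(x)\colon f\mapsto f(x)$, $x\in M$, in $\mathrm{Lip}_0(M)^*$. For $\lambda>0$, a Banach space $E$ has the $\lambda$-bounded approximation property if for all $x_1,\dots,x_n\in E$ and every $\varepsilon>0$ there is a finite-rank bounded linear operator $T\colon E\to E$ with $\|T\|\le\lambda$ and $\|x_i-Tx_i\|\le\varepsilon$ for $1\le i\le n$. **Proposition.** Let $X$ be a real Banach space and let $K\subset X$ be a closed convex subset containing $0$. Assume that there exist $\lambda\ge 1$ and a sequence $(T_n)_{n}$ of finite-rank bounded linear operators on $X$ such that $\|T_n\|\le\lambda$ and $T_n(K)\subset K$ for every $n$, and $T_nx\to x$ for every $x\in K$. Then $\mathcal F(K)$, with $0$ as base point of $K$, has the $\lambda$-bounded approximation property. -/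

import Mathlib

noncomputable section

/-- The vector space of Lipschitz functions `M → ℝ` vanishing at the base point `e`. -/
def lipZeroSubmodule (M : Type*) [MetricSpace M] (e : M) : Submodule ℝ (M → ℝ) where
  carrier := {f | (∃ C, LipschitzWith C f) ∧ f e = 0}
  zero_mem' := ⟨⟨0, LipschitzWith.const 0⟩, rfl⟩
  add_mem' := by
    rintro f g ⟨⟨C, hf⟩, hf0⟩ ⟨⟨D, hg⟩, hg0⟩
    exact ⟨⟨C + D, hf.add hg⟩, by simp [hf0, hg0]⟩
  smul_mem' := by
    rintro c f ⟨⟨C, hf⟩, hf0⟩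
    exact ⟨⟨‖c‖₊ * C, (lipschitzWith_smul c).comp hf⟩, by simp [hf0]⟩

/-- `Lip₀(M)`. This is a type of its own, so that it carries the Lipschitz norm and not the
topology of pointwise convergence. -/
def LipZero (M : Type*) [MetricSpace M] (e : M) : Type _ := lipZeroSubmodule M e

namespace LipZero

variable {M : Type*} [MetricSpace M] {e : M}

instance : AddCommGroup (LipZero M e) := inferInstanceAs (AddCommGroup (lipZeroSubmodule M e))

instance : Module ℝ (LipZero M e) := inferInstanceAs (Module ℝ (lipZeroSubmodule M e))

instance : CoeFun (LipZero M e) (fun _ => M → ℝ) := ⟨fun f => f.1⟩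

theorem ext_fun {f g : LipZero M e} (h : ∀ x, f x = g x) : f = g := Subtype.ext (funext h)

theorem add_apply (f g : LipZero M e) (x : M) : (f + g) x = f x + g x := rfl

theorem smul_apply (c : ℝ) (f : LipZero M e) (x : M) : (c • f) x = c * f x := rfl

theorem zero_apply (x : M) : (0 : LipZero M e) x = 0 := rfl

theorem apply_base (f : LipZero M e) : f e = 0 := f.2.2

/-- The difference quotients of a function. -/
def slopes (f : M → ℝ) : Set ℝ := {r | ∃ x y : M, x ≠ y ∧ r = (f x - f y) / dist x y}

/-- The norm `‖f‖_L = sup {(f x - f y) / d(x, y) : x ≠ y}` (equal to `0` on a one-point space). -/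
instance : Norm (LipZero M e) := ⟨fun f => sSup (slopes f)⟩

theorem norm_def (f : LipZero M e) : ‖f‖ = sSup (slopes f) := rfl

theorem bddAbove_slopes (f : LipZero M e) : BddAbove (slopes f) := by
  obtain ⟨C, hC⟩ := f.2.1
  refine ⟨C, ?_⟩
  rintro r ⟨x, y, hxy, rfl⟩
  rw [div_le_iff₀ (dist_pos.2 hxy)]
  exact (le_abs_self _).trans (hC.dist_le_mul x y)

theorem sub_le_norm_mul (f : LipZero M e) (x y : M) : f x - f y ≤ ‖f‖ * dist x y := by
  rcases eq_or_ne x y with rfl | h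
  · simp
  · rw [← div_le_iff₀ (dist_pos.2 h)]
    exact le_csSup (bddAbove_slopes f) ⟨x, y, h, rfl⟩

theorem norm_le_of (f : LipZero M e) {C : ℝ} (hC : 0 ≤ C)
    (h : ∀ x y, f x - f y ≤ C * dist x y) : ‖f‖ ≤ C := by
  refine Real.sSup_le ?_ hC
  rintro r ⟨x, y, hxy, rfl⟩
  rw [div_le_iff₀ (dist_pos.2 hxy)]
  exact h x y

theorem norm_nonneg_aux (f : LipZero M e) : 0 ≤ ‖f‖ := by
  by_cases h : ∃ x y : M, x ≠ y
  · obtain ⟨x, y, hxy⟩ := h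
    have h1 := sub_le_norm_mul f x y
    have h2 := sub_le_norm_mul f y x
    rw [dist_comm y x] at h2
    have h3 := dist_pos.2 hxy
    by_contra hn
    nlinarith [mul_pos (neg_pos.2 (not_le.1 hn)) h3]
  · refine Real.sSup_nonneg ?_
    rintro r ⟨x, y, hxy, rfl⟩
    exact absurd ⟨x, y, hxy⟩ h

theorem norm_smul_le_aux (c : ℝ) (f : LipZero M e) : ‖c • f‖ ≤ ‖c‖ * ‖f‖ := by
  refine norm_le_of _ (mul_nonneg (norm_nonneg c) (norm_nonneg_aux f)) fun x y => ?_
  rw [smul_apply, smul_apply, ← mul_sub, mul_assoc]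
  refine (le_abs_self _).trans ?_
  rw [abs_mul, Real.norm_eq_abs]
  refine mul_le_mul_of_nonneg_left (abs_le.2 ⟨?_, sub_le_norm_mul f x y⟩) (abs_nonneg c)
  have := sub_le_norm_mul f y x
  rw [dist_comm y x] at this
  linarith

theorem norm_core : NormedSpace.Core ℝ (LipZero M e) where
  norm_nonneg := norm_nonneg_aux
  norm_smul c f := by
    refine le_antisymm (norm_smul_le_aux c f) ?_
    rcases eq_or_ne c 0 with rfl | hc
    · simpa using norm_nonneg_aux ((0 : ℝ) • f)
    · have h := norm_smul_le_aux c⁻¹ (c • f)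
      rw [inv_smul_smul₀ hc, norm_inv] at h
      have hc' : 0 < ‖c‖ := norm_pos_iff.2 hc
      calc ‖c‖ * ‖f‖ ≤ ‖c‖ * (‖c‖⁻¹ * ‖c • f‖) := mul_le_mul_of_nonneg_left h hc'.le
        _ = ‖c • f‖ := by rw [← mul_assoc, mul_inv_cancel₀ hc'.ne', one_mul]
  norm_triangle f g := by
    refine norm_le_of _ (add_nonneg (norm_nonneg_aux f) (norm_nonneg_aux g)) fun x y => ?_
    have h1 := sub_le_norm_mul f x y
    have h2 := sub_le_norm_mul g x y
    rw [add_apply, add_apply, add_mul]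
    linarith
  norm_eq_zero_iff f := by
    constructor
    · intro h
      refine ext_fun fun x => ?_
      have h1 := sub_le_norm_mul f x e
      have h2 := sub_le_norm_mul f e x
      rw [h, zero_mul, apply_base] at h1 h2
      rw [zero_apply]
      linarith
    · rintro rfl
      refine le_antisymm (norm_le_of _ le_rfl fun x y => ?_) (norm_nonneg_aux _)
      simp [zero_apply]

instance : NormedAddCommGroup (LipZero M e) := NormedAddCommGroup.ofCore norm_core

instance : NormedSpace ℝ (LipZero M e) := NormedSpace.ofCore norm_core

/-- The evaluation functional `δ(x) : f ↦ f x`, an element of `Lip₀(M)^*`. -/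
def delta (e x : M) : StrongDual ℝ (LipZero M e) :=
  LinearMap.mkContinuous
    { toFun := fun f => f x
      map_add' := fun f g => add_apply f g x
      map_smul' := fun c f => smul_apply c f x }
    (dist x e) (fun f => by
      have h1 := sub_le_norm_mul f x e
      have h2 := sub_le_norm_mul f e x
      rw [dist_comm e x] at h2
      rw [apply_base] at h1 h2
      change |f x| ≤ dist x e * ‖f‖
      rw [mul_comm]
      exact abs_le.2 ⟨by linarith, by linarith⟩)

end LipZero

/-- The Lipschitz free space `F(M)`: the norm-closed linear span of the evaluation functionals
in `Lip₀(M)^*`, with the dual norm. -/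
abbrev LipschitzFree (M : Type*) [MetricSpace M] (e : M) : Type _ :=
  (Submodule.span ℝ (Set.range (LipZero.delta e))).topologicalClosure

/-- The `l`-bounded approximation property, for `l > 0`. -/
def HasBAP (l : ℝ) (E : Type*) [NormedAddCommGroup E] [NormedSpace ℝ E] : Prop :=
  0 < l ∧ ∀ (n : ℕ) (x : Fin n → E) (ε : ℝ), 0 < ε →
    ∃ T : E →L[ℝ] E, FiniteDimensional ℝ T.range ∧ ‖T‖ ≤ l ∧ ∀ i, ‖x i - T (x i)‖ ≤ ε

end

/-! A `λ`-Lipschitz map `φ : K → F(K)` with `φ 0 = 0` and values in a finite-dimensional subspace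
extends to a finite-rank operator of norm at most `λ` (`LipZero.exists_linearization`). This
operator is close to the identity at prescribed vectors once `φ` is close to `δ` at finitely many
points (`hasBAP_of_forall_finset`). To build `φ`, a nonexpansive map squeezes `K` into a bounded
part of itself, and `T n` carries that part into a bounded convex finite-dimensional piece `C` of
`K`. On `C`, a nonexpansive map with finite-dimensional span approximates `δ`
(`exists_finiteDimensional_nonexpansive_near`), so the factor `λ` comes from `T n` alone.

That approximation is a convolution. If the kernel is a combination of exponentials of linear
functionals, the values span a finite-dimensional space; by Stone–Weierstrass such kernels come
uniformly close to a bump function on compact sets. The kernel error slightly worsens the Lipschitz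
constant, so `δ` is first composed with a `(1 - t)`-contraction towards an interior point of `C`.
This absorbs the loss and also defines the map on a neighbourhood of `C`. -/

/-! ### Exponential kernels -/

/-- The functions `x ↦ exp (φ x)`, with `φ` a continuous linear functional. -/
def expLinear (E : Type*) [NormedAddCommGroup E] [NormedSpace ℝ E] : Submonoid C(E, ℝ) where
  carrier := Set.range fun φ : StrongDual ℝ E => ⟨fun x => Real.exp (φ x), by fun_prop⟩
  one_mem' := ⟨0, by ext; simp⟩
  mul_mem' := by
    rintro _ _ ⟨φ, rfl⟩ ⟨ψ, rfl⟩
    exact ⟨φ + ψ, by ext; simp [Real.exp_add]⟩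

/-- A continuous function on a normed space is uniformly approximated on compact sets by linear
combinations of exponentials of linear functionals. -/
theorem exists_span_expLinear_near {E : Type*} [NormedAddCommGroup E] [NormedSpace ℝ E]
    (f : C(E, ℝ)) {Q : Set E} (hQ : IsCompact Q) {ε : ℝ} (hε : 0 < ε) :
    ∃ g ∈ Submodule.span ℝ (expLinear E : Set C(E, ℝ)), ∀ x ∈ Q, |g x - f x| < ε := by
  have hsep : (Algebra.adjoin ℝ (expLinear E : Set C(E, ℝ))).SeparatesPoints := by
    intro x y hxy
    obtain ⟨φ, hφ⟩ := SeparatingDual.exists_separating_of_ne (R := ℝ) hxy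
    refine ⟨fun x => Real.exp (φ x), ⟨⟨fun x => Real.exp (φ x), by fun_prop⟩,
      Algebra.subset_adjoin ⟨φ, rfl⟩, rfl⟩, ?_⟩
    simpa using hφ
  obtain ⟨g, hg, h⟩ :=
    ContinuousMap.exists_mem_subalgebra_near_continuous_of_isCompact_of_separatesPoints
      hsep f hQ hε
  refine ⟨g, ?_, h⟩
  -- The exponentials are closed under products, so the algebra they generate is just their linear
  -- span.
  rwa [← Subalgebra.mem_toSubmodule, Algebra.adjoin_eq_span, Submonoid.closure_eq] at hg

open MeasureTheory in
/-- Convolution with a linear combination of exponentials of linear functionals takes values in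
a finite-dimensional space. -/
theorem exists_finiteDimensional_integral_mem {E V : Type*} [NormedAddCommGroup E]
    [NormedSpace ℝ E] [MeasurableSpace E] [BorelSpace E] (μ : Measure E)
    [IsFiniteMeasureOnCompacts μ] [NormedAddCommGroup V] [NormedSpace ℝ V]
    {F : E → V} (hF : Continuous F) (hF' : HasCompactSupport F) {p : C(E, ℝ)}
    (hp : p ∈ Submodule.span ℝ (expLinear E : Set C(E, ℝ))) :
    ∃ W : Submodule ℝ V, FiniteDimensional ℝ W ∧ ∀ x, ∫ u, p (x - u) • F u ∂μ ∈ W := by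
  have hpF (p : C(E, ℝ)) (x : E) : Integrable (fun u => p (x - u) • F u) μ :=
    Continuous.integrable_of_hasCompactSupport (by fun_prop) hF'.smul_left
  induction hp using Submodule.span_induction with
  | mem p hp =>
    obtain ⟨φ, rfl⟩ := hp
    refine ⟨Submodule.span ℝ {∫ u, Real.exp (-φ u) • F u ∂μ}, inferInstance, fun x => ?_⟩
    -- The exponential turns the difference into a product, so `x` enters only through a scalar
    -- factor.
    have : ∫ u, Real.exp (φ (x - u)) • F u ∂μ =
        Real.exp (φ x) • ∫ u, Real.exp (-φ u) • F u ∂μ := by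
      rw [← integral_smul]
      congr 1 with u
      rw [smul_smul, ← Real.exp_add, map_sub, sub_eq_add_neg]
    simp only [ContinuousMap.coe_mk]
    rw [this]
    exact Submodule.smul_mem _ _ (Submodule.mem_span_singleton_self _)
  | zero => exact ⟨⊥, inferInstance, fun x => by simp⟩
  | add p q _ _ hp hq =>
    obtain ⟨W, _, hW⟩ := hp
    obtain ⟨W', _, hW'⟩ := hq
    refine ⟨W ⊔ W', inferInstance, fun x => ?_⟩
    simp only [ContinuousMap.add_apply, add_smul]
    rw [integral_add (hpF p x) (hpF q x)]
    exact Submodule.add_mem_sup (hW x) (hW' x)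
  | smul a p _ hp =>
    obtain ⟨W, hW, h⟩ := hp
    refine ⟨W, hW, fun x => ?_⟩
    simp only [ContinuousMap.smul_apply, smul_assoc, integral_smul]
    exact W.smul_mem a (h x)

/-! ### Finite-dimensional smoothing on a convex body -/

open Metric in
/-- A Lipschitz map on a bounded convex body `C`, precomposed with a contraction towards an
interior point, extends to a compactly supported Lipschitz map that is still contracting
near `C`. -/
theorem exists_lipschitz_extension_contracting {E V : Type*} [NormedAddCommGroup E]
    [NormedSpace ℝ E] [NormedAddCommGroup V] [NormedSpace ℝ V]
    {C : Set E} (hC : Convex ℝ C) {R : ℝ} (hR : C ⊆ closedBall 0 R) {c : E} {s : ℝ} (hs : 0 < s)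
    (hs1 : s ≤ 1) (hc : closedBall c s ⊆ C) {f : E → V}
    (hf : ∀ x ∈ C, ∀ y ∈ C, ‖f x - f y‖ ≤ ‖x - y‖) {t : ℝ} (ht : 0 < t) (ht1 : t < 1) :
    ∃ (F : E → V) (M D r R' : ℝ), 0 < M ∧ 0 ≤ D ∧ 0 < r ∧ r ≤ t ∧
      (∀ x y, ‖F x - F y‖ ≤ M * ‖x - y‖) ∧ (∀ x, ‖F x‖ ≤ D) ∧ (∀ x, F x ≠ 0 → ‖x‖ ≤ R') ∧
      ∀ x ∈ C, ∀ z, ‖z‖ ≤ r → (∀ y ∈ C, ‖F (x - z) - F (y - z)‖ ≤ (1 - t) * ‖x - y‖) ∧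
        ‖F (x - z) - f x‖ ≤ t * (2 * R + 1) := by
  have hcC : c ∈ C := hc (mem_closedBall_self hs.le)
  have hne : C.Nonempty := ⟨c, hcC⟩
  have hnR {x : E} (hx : x ∈ C) : ‖x‖ ≤ R := by simpa using hR hx
  have hR0 : 0 ≤ R := (norm_nonneg c).trans (hnR hcC)
  -- The contraction `A` below sends the `t * s`-neighbourhood of `C` into `C`; the cutoff `χ` falls
  -- from 1 to 0 between distances `r` and `2 * r = t * s`.
  set r := t * s / 2 with hr_def
  have hr : 0 < r := by positivity
  have hrt : r ≤ t := by rw [hr_def]; nlinarith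
  set A : E → E := fun x => c + (1 - t) • (x - c) with hA_def
  have hA_sub (x y : E) : A x - A y = (1 - t) • (x - y) := by
    simp only [hA_def, smul_sub]; abel
  have hA_norm (x y : E) : ‖A x - A y‖ = (1 - t) * ‖x - y‖ := by
    rw [hA_sub, norm_smul, Real.norm_of_nonneg (by linarith)]
  have hA_mem {x : E} (hx : infDist x C < 2 * r) : A x ∈ C := by
    obtain ⟨y, hy, hxy⟩ := (infDist_lt_iff hne).1 hx
    -- `A x` is the convex combination of `y` and this point with weights `1 - t` and `t`.
    have hb : c + ((1 - t) / t) • (x - y) ∈ C := by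
      apply hc
      rw [mem_closedBall_iff_norm, add_sub_cancel_left, norm_smul, Real.norm_of_nonneg
        (div_nonneg (by linarith) ht.le), ← dist_eq_norm]
      calc (1 - t) / t * dist x y ≤ (1 - t) / t * (t * s) := by
            have : 0 ≤ (1 - t) / t := div_nonneg (by linarith) ht.le
            gcongr
            linarith
        _ = (1 - t) * s := by field_simp
        _ ≤ s := by nlinarith
    have := hC hy hb (by linarith : 0 ≤ 1 - t) ht.le (by ring)
    convert this using 1
    rw [smul_add, smul_smul, mul_div_cancel₀ _ ht.ne']
    simp only [hA_def, smul_sub, sub_smul, one_smul]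
    abel
  set D := ‖f c‖ + 2 * R with hD_def
  have hD0 : 0 ≤ D := by positivity
  have hfD {x : E} (hx : x ∈ C) : ‖f x‖ ≤ D := by
    have h1 := hf x hx c hcC
    have h2 := norm_sub_le x c
    have h3 := hnR hx
    have h4 := hnR hcC
    have h5 := norm_le_norm_add_norm_sub' (f x) (f c)
    linarith
  set χ : E → ℝ := fun x => max 0 (min 1 (2 - infDist x C / r)) with hχ_def
  have hχ0 (x : E) : 0 ≤ χ x := le_max_left _ _
  have hχ1 (x : E) : χ x ≤ 1 := max_le zero_le_one (min_le_left _ _)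
  have hχ_lip (x y : E) : |χ x - χ y| ≤ ‖x - y‖ / r := by
    have h1 : |χ x - χ y| ≤ |(2 - infDist x C / r) - (2 - infDist y C / r)| := by
      refine (abs_max_sub_max_le_max _ _ _ _).trans (max_le (by simp) ?_)
      exact (abs_min_sub_min_le_max _ _ _ _).trans (max_le (by simp) le_rfl)
    refine h1.trans ?_
    have h2 : |infDist x C - infDist y C| ≤ ‖x - y‖ := by
      simpa [Real.dist_eq, dist_eq_norm] using (lipschitz_infDist_pt C).dist_le_mul x y
    rw [sub_sub_sub_cancel_left, ← sub_div, abs_div, abs_of_pos hr, abs_sub_comm]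
    gcongr
  have hχ_one {x : E} (hx : infDist x C ≤ r) : χ x = 1 := by
    have : infDist x C / r ≤ 1 := (div_le_one hr).2 hx
    rw [hχ_def]
    simp only
    rw [min_eq_left (by linarith), max_eq_right zero_le_one]
  have hχ_zero {x : E} (hx : ¬ infDist x C < 2 * r) : χ x = 0 := by
    have : 2 ≤ infDist x C / r := (le_div_iff₀ hr).2 (not_lt.1 hx)
    rw [hχ_def]
    simp only
    rw [max_eq_left]
    exact (min_le_right _ _).trans (by linarith)
  set F : E → V := fun x => χ x • f (A x) with hF_def
  have hF_zero {x : E} (hx : ¬ infDist x C < 2 * r) : F x = 0 := by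
    simp [hF_def, hχ_zero hx]
  -- Only `y` need be near `C`: in the splitting `h5`, the uncontrolled value `f (A x)` carries the
  -- factor `χ x`, which vanishes when `x` is far away.
  have key (x y : E) (hy : infDist y C < 2 * r) : ‖F x - F y‖ ≤ (1 + D / r) * ‖x - y‖ := by
    have h2 : ‖(χ x - χ y) • f (A y)‖ ≤ D / r * ‖x - y‖ := by
      rw [norm_smul, Real.norm_eq_abs]
      calc |χ x - χ y| * ‖f (A y)‖ ≤ ‖x - y‖ / r * D := by
            gcongr
            exacts [hχ_lip x y, hfD (hA_mem hy)]
        _ = D / r * ‖x - y‖ := by ring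
    have h1 : ‖χ x • (f (A x) - f (A y))‖ ≤ ‖x - y‖ := by
      by_cases hx : infDist x C < 2 * r
      · rw [norm_smul, Real.norm_of_nonneg (hχ0 x)]
        have h3 := hf _ (hA_mem hx) _ (hA_mem hy)
        rw [hA_norm] at h3
        have h4 : (1 - t) * ‖x - y‖ ≤ ‖x - y‖ := by nlinarith [norm_nonneg (x - y)]
        calc χ x * ‖f (A x) - f (A y)‖ ≤ 1 * ‖x - y‖ := by
              gcongr
              exacts [hχ1 x, h3.trans h4]
          _ = ‖x - y‖ := one_mul _
      · simp [hχ_zero hx]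
    have h5 : F x - F y = χ x • (f (A x) - f (A y)) + (χ x - χ y) • f (A y) := by
      simp only [hF_def, smul_sub, sub_smul]; abel
    rw [h5, add_mul, one_mul]
    exact (norm_add_le _ _).trans (add_le_add h1 h2)
  have hnear {x z : E} (hx : x ∈ C) (hz : ‖z‖ ≤ r) : infDist (x - z) C ≤ r := by
    refine (infDist_le_dist_of_mem hx).trans ?_
    simpa [dist_eq_norm] using hz
  have hnear_eq {x z : E} (hx : x ∈ C) (hz : ‖z‖ ≤ r) : F (x - z) = f (A (x - z)) := by
    simp [hF_def, hχ_one (hnear hx hz)]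
  have hnear_mem {x z : E} (hx : x ∈ C) (hz : ‖z‖ ≤ r) : A (x - z) ∈ C :=
    hA_mem ((hnear hx hz).trans_lt (by linarith))
  refine ⟨F, 1 + D / r, D, r, R + 2 * r, by positivity, hD0, hr, hrt, fun x y => ?_, fun x => ?_,
    fun x hx => ?_, fun x hx z hz => ⟨fun y hy => ?_, ?_⟩⟩
  · by_cases hy : infDist y C < 2 * r
    · exact key x y hy
    · by_cases hx : infDist x C < 2 * r
      · rw [norm_sub_rev, norm_sub_rev x]
        exact key y x hx
      · rw [hF_zero hx, hF_zero hy, sub_zero, norm_zero]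
        positivity
  · by_cases hx : infDist x C < 2 * r
    · rw [hF_def]
      simp only
      rw [norm_smul, Real.norm_of_nonneg (hχ0 x)]
      nlinarith [hfD (hA_mem hx), hχ1 x, hχ0 x, norm_nonneg (f (A x))]
    · rw [hF_zero hx, norm_zero]
      exact hD0
  · have hx' : infDist x C < 2 * r := by
      by_contra h
      exact hx (hF_zero h)
    obtain ⟨y, hy, hxy⟩ := (infDist_lt_iff hne).1 hx'
    rw [dist_eq_norm] at hxy
    linarith [norm_le_norm_add_norm_sub' x y, hnR hy]
  · rw [hnear_eq hx hz, hnear_eq hy hz]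
    refine (hf _ (hnear_mem hx hz) _ (hnear_mem hy hz)).trans_eq ?_
    rw [hA_norm, sub_sub_sub_cancel_right]
  · rw [hnear_eq hx hz]
    refine (hf _ (hnear_mem hx hz) _ hx).trans ?_
    have h1 : A (x - z) - x = t • (c - x) - (1 - t) • z := by
      simp only [hA_def, smul_sub, sub_smul, one_smul]; abel
    rw [h1]
    refine (norm_sub_le _ _).trans ?_
    rw [norm_smul, norm_smul, Real.norm_of_nonneg ht.le, Real.norm_of_nonneg (by linarith)]
    have h2 : ‖c - x‖ ≤ 2 * R := by linarith [norm_sub_le c x, hnR hx, hnR hcC]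
    nlinarith [norm_nonneg z]

open MeasureTheory Metric in
/-- A nonexpansive map from a bounded convex body of a finite-dimensional space to a Banach space
is a uniform limit of nonexpansive maps with finite-dimensional span. -/
theorem exists_finiteDimensional_nonexpansive_near {E V : Type*} [NormedAddCommGroup E]
    [NormedSpace ℝ E] [FiniteDimensional ℝ E] [NormedAddCommGroup V] [NormedSpace ℝ V]
    [CompleteSpace V] {C : Set E} (hC : Convex ℝ C) (hCb : Bornology.IsBounded C)
    (hCi : (interior C).Nonempty) {f : E → V}
    (hf : ∀ x ∈ C, ∀ y ∈ C, ‖f x - f y‖ ≤ ‖x - y‖) {ε : ℝ} (hε : 0 < ε) :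
    ∃ (φ : E → V) (W : Submodule ℝ V), FiniteDimensional ℝ W ∧ (∀ x ∈ C, φ x ∈ W) ∧
      (∀ x ∈ C, ∀ y ∈ C, ‖φ x - φ y‖ ≤ ‖x - y‖) ∧ ∀ x ∈ C, ‖φ x - f x‖ ≤ ε := by
  borelize E
  let μ : Measure E := Measure.addHaar
  obtain ⟨c, hc⟩ := hCi
  obtain ⟨s₀, hs₀, hcs₀⟩ := nhds_basis_closedBall.mem_iff.1 (mem_interior_iff_mem_nhds.1 hc)
  obtain ⟨R, hR⟩ := hCb.subset_closedBall (0 : E)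
  have hnR {x : E} (hx : x ∈ C) : ‖x‖ ≤ R := by simpa using hR hx
  have hR0 : 0 ≤ R := (norm_nonneg c).trans (hnR (interior_subset hc))
  -- The final error is `t * (2 * R + 1)` from contracting and smoothing, plus `t` from replacing
  -- the kernel.
  obtain ⟨t, ht, ht'⟩ : ∃ t : ℝ, 0 < t ∧ t < min 1 (ε / (2 * R + 2)) :=
    exists_between (lt_min one_pos (by positivity))
  have ht1 : t < 1 := ht'.trans_le (min_le_left _ _)
  have htε : t * (2 * R + 2) ≤ ε :=
    ((lt_div_iff₀ (by positivity)).1 (ht'.trans_le (min_le_right _ _))).le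
  obtain ⟨F, M, D, r, R', hM, hD, hr, -, hF_lip, hF_bd, hF_supp, hF_near⟩ :=
    exists_lipschitz_extension_contracting hC hR (lt_min hs₀ one_pos) (min_le_right _ _)
      ((closedBall_subset_closedBall (min_le_left _ _)).trans hcs₀) hf ht ht1
  have hF_cont : Continuous F :=
    (LipschitzWith.of_dist_le_mul (K := M.toNNReal) fun x y => by
      simpa [dist_eq_norm, hM.le] using hF_lip x y).continuous
  have hF_cs : HasCompactSupport F :=
    HasCompactSupport.intro (isCompact_closedBall 0 R') fun x hx => by
      by_contra h
      exact hx (by simpa using hF_supp x h)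
  let ψ : ContDiffBump (0 : E) := ⟨r / 2, r, by positivity, by linarith⟩
  set k : E → ℝ := ψ.normed μ
  have hk0 (z : E) : 0 ≤ k z := ψ.nonneg_normed z
  have hkr {z : E} (hz : k z ≠ 0) : ‖z‖ < r := by
    have : z ∈ Function.support (ψ.normed μ) := hz
    rw [ψ.support_normed_eq] at this
    simpa using this
  have hk_int : Integrable k μ := ψ.integrable_normed
  -- `Q` contains the support of `k` and every `z` with `F (x - z) ≠ 0` for some `x ∈ C`. The
  -- behaviour of `p` outside `Q` is therefore harmless.
  set Q : Set E := closedBall 0 (max r (R + R')) with hQ_def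
  have hQc : IsCompact Q := isCompact_closedBall _ _
  have hkQ : ∫ z in Q, k z ∂μ = 1 := by
    rw [setIntegral_eq_integral_of_forall_compl_eq_zero, ψ.integral_normed]
    intro z hz
    by_contra h
    exact hz (by simpa [hQ_def] using Or.inl (hkr h).le)
  set v := μ.real Q
  have hv : 0 ≤ v := measureReal_nonneg
  -- Kernel accuracy: the loss `d * M * v` in the Lipschitz constant fits into the slack `t`, and so
  -- does the uniform error `d * D * v`.
  set d := t / ((M + D) * v + 1)
  have hd : 0 < d := by positivity
  have hdt : d * (M + D) * v ≤ t := by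
    have : d * ((M + D) * v + 1) = t := div_mul_cancel₀ _ (by positivity)
    linarith
  obtain ⟨p, hp, hpk⟩ := exists_span_expLinear_near ⟨k, ψ.continuous_normed⟩ hQc hd
  simp only [ContinuousMap.coe_mk] at hpk
  obtain ⟨W, hWfin, hW⟩ := exists_finiteDimensional_integral_mem μ hF_cont hF_cs hp
  have hbound_int (a b : ℝ) : IntegrableOn (fun z => k z * a + b) Q μ :=
    (hk_int.integrableOn.mul_const a).add (continuous_const.continuousOn.integrableOn_compact hQc)
  have hbound_eq (a b : ℝ) : ∫ z in Q, (k z * a + b) ∂μ = a + b * v := by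
    rw [integral_add (hk_int.integrableOn.mul_const a)
      (continuous_const.continuousOn.integrableOn_compact hQc), integral_mul_const, hkQ,
      setIntegral_const, smul_eq_mul, one_mul, mul_comm b]
  have hφ_int (x : E) : IntegrableOn (fun z => p z • F (x - z)) Q μ :=
    ContinuousOn.integrableOn_compact hQc (by fun_prop)
  have hp_smul {z : E} (hz : z ∈ Q) {w : V} {a b : ℝ} (hw : k z ≠ 0 → ‖w‖ ≤ a)
      (hw' : ‖w‖ ≤ b) : ‖p z • w‖ ≤ k z * a + d * b := by
    have h1 : p z • w = k z • w + (p z - k z) • w := by rw [sub_smul]; abel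
    rw [h1]
    refine (norm_add_le _ _).trans (add_le_add ?_ ?_)
    · rw [norm_smul, Real.norm_of_nonneg (hk0 z)]
      by_cases h : k z = 0
      · simp [h]
      · exact mul_le_mul_of_nonneg_left (hw h) (hk0 z)
    · rw [norm_smul, Real.norm_eq_abs]
      exact mul_le_mul (hpk z hz).le hw' (norm_nonneg _) hd.le
  refine ⟨fun x => ∫ z in Q, p z • F (x - z) ∂μ, W, hWfin, fun x hx => ?_, fun x hx y hy => ?_,
    fun x hx => ?_⟩
  · simp only
    rw [setIntegral_eq_integral_of_forall_compl_eq_zero]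
    -- The substitution `u = x - z` moves `x` from `F` into the kernel.
    · have := integral_sub_left_eq_self (fun z => p z • F (x - z)) μ x
      simp only [sub_sub_cancel] at this
      rw [← this]
      exact hW x
    · intro z hz
      by_contra h
      have h1 : ‖x - z‖ ≤ R' := hF_supp _ fun h' => h (by simp [h'])
      refine hz ?_
      rw [hQ_def, mem_closedBall_zero_iff]
      refine le_max_of_le_right ?_
      have := norm_sub_le x (x - z)
      rw [sub_sub_cancel] at this
      linarith [hnR hx]
  · simp only
    rw [← integral_sub (hφ_int x) (hφ_int y)]
    calc ‖∫ z in Q, (p z • F (x - z) - p z • F (y - z)) ∂μ‖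
        ≤ ∫ z in Q, (k z * ((1 - t) * ‖x - y‖) + d * (M * ‖x - y‖)) ∂μ := by
          refine norm_integral_le_of_norm_le (hbound_int _ _) ?_
          filter_upwards [ae_restrict_mem measurableSet_closedBall] with z hz
          rw [← smul_sub]
          refine hp_smul hz (fun h => (hF_near x hx z (hkr h).le).1 y hy) ?_
          simpa using hF_lip (x - z) (y - z)
      _ = ((1 - t) + d * M * v) * ‖x - y‖ := by rw [hbound_eq]; ring
      _ ≤ 1 * ‖x - y‖ := by
          gcongr
          have : 0 ≤ d * D * v := by positivity
          linarith
      _ = ‖x - y‖ := one_mul _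
  · have h1 : ∫ z in Q, k z • f x ∂μ = f x := by rw [integral_smul_const, hkQ, one_smul]
    simp only
    nth_rw 1 [← h1]
    rw [← integral_sub (hφ_int x) (hk_int.integrableOn.smul_const _)]
    calc ‖∫ z in Q, (p z • F (x - z) - k z • f x) ∂μ‖
        ≤ ∫ z in Q, (k z * (t * (2 * R + 1)) + d * D) ∂μ := by
          refine norm_integral_le_of_norm_le (hbound_int _ _) ?_
          filter_upwards [ae_restrict_mem measurableSet_closedBall] with z hz
          have h2 : p z • F (x - z) - k z • f x =
              k z • (F (x - z) - f x) + (p z - k z) • F (x - z) := by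
            simp only [sub_smul, smul_sub]; abel
          rw [h2]
          refine (norm_add_le _ _).trans (add_le_add ?_ ?_)
          · rw [norm_smul, Real.norm_of_nonneg (hk0 z)]
            by_cases h : k z = 0
            · simp [h]
            · exact mul_le_mul_of_nonneg_left (hF_near x hx z (hkr h).le).2 (hk0 z)
          · rw [norm_smul, Real.norm_eq_abs]
            exact mul_le_mul (hpk z hz).le (hF_bd _) (norm_nonneg _) hd.le
      _ = t * (2 * R + 1) + d * D * v := by rw [hbound_eq]
      _ ≤ ε := by
          have : 0 ≤ d * M * v := by positivity
          linarith

/-! ### A bounded nonexpansive map -/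

/-- The map `x ↦ (1 + η ‖x‖)⁻¹ • x` is nonexpansive. -/
theorem norm_inv_one_add_smul_sub_le {X : Type*} [NormedAddCommGroup X] [NormedSpace ℝ X]
    {η : ℝ} (hη : 0 < η) (x y : X) :
    ‖(1 + η * ‖x‖)⁻¹ • x - (1 + η * ‖y‖)⁻¹ • y‖ ≤ ‖x - y‖ := by
  wlog hxy : ‖y‖ ≤ ‖x‖ generalizing x y
  · rw [norm_sub_rev, norm_sub_rev x]
    exact this y x (not_le.1 hxy).le
  set a := ‖x‖ with ha
  set b := ‖y‖ with hb
  have hb0 : 0 ≤ b := norm_nonneg y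
  have ha0 : 0 ≤ a := norm_nonneg x
  have hab : a - b ≤ ‖x - y‖ := norm_sub_norm_le x y
  have h1 : (1 + η * a)⁻¹ • x - (1 + η * b)⁻¹ • y =
      (1 + η * a)⁻¹ • (x - y) - ((1 + η * b)⁻¹ - (1 + η * a)⁻¹) • y := by
    simp only [smul_sub, sub_smul]; abel
  have h2 : (1 + η * b)⁻¹ - (1 + η * a)⁻¹ = η * (a - b) * ((1 + η * a)⁻¹ * (1 + η * b)⁻¹) := by
    field_simp; ring
  have h3 : 0 ≤ (1 + η * b)⁻¹ - (1 + η * a)⁻¹ := by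
    rw [h2]
    have := sub_nonneg.2 hxy
    positivity
  rw [h1]
  refine (norm_sub_le _ _).trans ?_
  rw [norm_smul, norm_smul, Real.norm_of_nonneg h3, Real.norm_of_nonneg (by positivity), ← hb, h2]
  have h4 : (1 + η * b)⁻¹ ≤ 1 := inv_le_one_of_one_le₀ (by linarith [mul_nonneg hη.le hb0])
  -- The coefficients `(1 + η * a)⁻¹` and `η * a * (1 + η * a)⁻¹` add up to exactly 1.
  calc (1 + η * a)⁻¹ * ‖x - y‖ + η * (a - b) * ((1 + η * a)⁻¹ * (1 + η * b)⁻¹) * b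
      ≤ (1 + η * a)⁻¹ * ‖x - y‖ + η * ‖x - y‖ * ((1 + η * a)⁻¹ * 1) * a := by gcongr
    _ = ‖x - y‖ := by field_simp

/-! ### Linearization of Lipschitz maps -/

namespace LipZero

variable {M : Type*} [MetricSpace M] {e : M}

theorem delta_apply (x : M) (f : LipZero M e) : delta e x f = f x := rfl

theorem delta_base : delta e e = 0 := by
  ext f
  exact f.apply_base

theorem norm_delta_sub_le (x y : M) : ‖delta e x - delta e y‖ ≤ dist x y := by
  refine ContinuousLinearMap.opNorm_le_bound _ dist_nonneg fun f => ?_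
  rw [sub_apply, delta_apply, delta_apply, Real.norm_eq_abs, mul_comm]
  have h1 := sub_le_norm_mul f x y
  have h2 := sub_le_norm_mul f y x
  rw [dist_comm y x] at h2
  exact abs_le.2 ⟨by linarith, by linarith⟩

/-- The composition of a Lipschitz map vanishing at the base point with a functional. -/
def ofDual {V : Type*} [NormedAddCommGroup V] [NormedSpace ℝ V] {φ : M → V} {L : NNReal}
    (hφ : LipschitzWith L φ) (h0 : φ e = 0) (ℓ : StrongDual ℝ V) : LipZero M e :=
  ⟨fun x => ℓ (φ x), ⟨_, ℓ.lipschitz.comp hφ⟩, by simp [h0]⟩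

theorem norm_ofDual_le {V : Type*} [NormedAddCommGroup V] [NormedSpace ℝ V] {φ : M → V}
    {L : NNReal} (hφ : LipschitzWith L φ) (h0 : φ e = 0) (ℓ : StrongDual ℝ V) :
    ‖ofDual hφ h0 ℓ‖ ≤ L * ‖ℓ‖ := by
  refine norm_le_of _ (by positivity) fun x y => ?_
  change ℓ (φ x) - ℓ (φ y) ≤ _
  rw [← map_sub]
  calc ℓ (φ x - φ y) ≤ ‖ℓ (φ x - φ y)‖ := le_abs_self _
    _ ≤ ‖ℓ‖ * ‖φ x - φ y‖ := ℓ.le_opNorm _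
    _ ≤ ‖ℓ‖ * (L * dist x y) := by
        gcongr
        rw [← dist_eq_norm]
        exact hφ.dist_le_mul x y
    _ = L * ‖ℓ‖ * dist x y := by ring

/-- Linearization of Lipschitz maps with values in a finite-dimensional subspace. -/
theorem exists_linearization {V : Type*} [NormedAddCommGroup V] [NormedSpace ℝ V] {φ : M → V}
    {L : NNReal} (hφ : LipschitzWith L φ) (h0 : φ e = 0) (W : Submodule ℝ V)
    [FiniteDimensional ℝ W] (hW : ∀ x, φ x ∈ W) :
    ∃ S : StrongDual ℝ (LipZero M e) →L[ℝ] V, ‖S‖ ≤ L ∧ (∀ m, S m ∈ W) ∧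
      ∀ x, S (delta e x) = φ x := by
  let b := Module.finBasis ℝ W
  have hcoord (i) : ∃ ℓ : StrongDual ℝ V, ∀ w : W, ℓ w = b.coord i w := by
    obtain ⟨ℓ, hℓ, -⟩ := exists_extension_norm_eq W (LinearMap.toContinuousLinearMap (b.coord i))
    exact ⟨ℓ, hℓ⟩
  choose ℓ hℓ using hcoord
  have hsum (w : V) (hw : w ∈ W) : ∑ i, ℓ i w • (b i : V) = w := by
    have h := congrArg W.subtype (b.sum_repr ⟨w, hw⟩)
    simp only [map_sum, map_smul, Submodule.subtype_apply, ← Module.Basis.coord_apply, ← hℓ] at h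
    exact h
  let S : StrongDual ℝ (LipZero M e) →L[ℝ] V :=
    ∑ i, (ContinuousLinearMap.apply ℝ ℝ (ofDual hφ h0 (ℓ i))).smulRight (b i : V)
  have hS (m) : S m = ∑ i, m (ofDual hφ h0 (ℓ i)) • (b i : V) := by
    simp [S]
  -- This formula characterizes `S m` without the basis, so bounding `S` by duality loses no
  -- constant.
  have hdual (q : StrongDual ℝ V) (m) : q (S m) = m (ofDual hφ h0 q) := by
    have h1 : ofDual hφ h0 q = ∑ i, q (b i) • ofDual hφ h0 (ℓ i) := by
      refine Subtype.ext (funext fun x => ?_)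
      have h2 : ∀ (s : Finset (Fin (Module.finrank ℝ W))),
          (∑ i ∈ s, q (b i) • ofDual hφ h0 (ℓ i)) x = ∑ i ∈ s, q (b i) * ℓ i (φ x) := by
        intro s
        simp only [← delta_apply, map_sum, map_smul]
        rfl
      refine Eq.trans ?_ (h2 Finset.univ).symm
      change q (φ x) = _
      conv_lhs => rw [← hsum (φ x) (hW x)]
      simp [mul_comm]
    rw [hS, h1]
    simp [mul_comm]
  refine ⟨S, ?_, fun m => ?_, fun x => ?_⟩
  · refine ContinuousLinearMap.opNorm_le_bound _ L.2 fun m => ?_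
    refine NormedSpace.norm_le_dual_bound ℝ _ (by positivity) fun q => ?_
    rw [hdual]
    calc ‖m (ofDual hφ h0 q)‖ ≤ ‖m‖ * ‖ofDual hφ h0 q‖ := m.le_opNorm _
      _ ≤ ‖m‖ * (L * ‖q‖) := by gcongr; exact norm_ofDual_le hφ h0 q
      _ = L * ‖m‖ * ‖q‖ := by ring
  · rw [hS]
    exact W.sum_mem fun i _ => W.smul_mem _ (b i).2
  · rw [hS]
    exact hsum (φ x) (hW x)

end LipZero

/-! ### From Lipschitz maps to the approximation property -/

/-- A nonexpansive map of a pointed metric space into a normed space, with dense linear span, such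
that Lipschitz maps with finite-dimensional span extend to operators of the same norm. -/
structure IsFreeEmbedding {M : Type*} [MetricSpace M] (e : M) {V : Type*} [NormedAddCommGroup V]
    [NormedSpace ℝ V] (δ : M → V) : Prop where
  base : δ e = 0
  norm_sub_le : ∀ x y, ‖δ x - δ y‖ ≤ dist x y
  mem_closure_span : ∀ m, m ∈ closure (Submodule.span ℝ (Set.range δ) : Set V)
  linearize : ∀ (φ : M → V) (L : NNReal) (W : Submodule ℝ V), FiniteDimensional ℝ W →
    LipschitzWith L φ → φ e = 0 → (∀ x, φ x ∈ W) →
    ∃ S : V →L[ℝ] V, ‖S‖ ≤ L ∧ (∀ m, S m ∈ W) ∧ ∀ x, S (δ x) = φ x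

/-- The point of the Lipschitz free space given by a point of `M`. -/
noncomputable def LipschitzFree.ofPoint {M : Type*} [MetricSpace M] (e x : M) :
    LipschitzFree M e :=
  ⟨LipZero.delta e x, Submodule.le_topologicalClosure _ (Submodule.subset_span ⟨x, rfl⟩)⟩

/-- Closure in a subspace is the trace of the ambient closure, and the inclusion carries one span
onto the other. -/
theorem Submodule.mem_closure_span_range_codRestrict {ι D : Type*} [NormedAddCommGroup D]
    [NormedSpace ℝ D] (δ : ι → D) (m : (Submodule.span ℝ (Set.range δ)).topologicalClosure)
    (δ' : ι → (Submodule.span ℝ (Set.range δ)).topologicalClosure) (h : ∀ i, (δ' i : D) = δ i) :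
    m ∈ closure (Submodule.span ℝ (Set.range δ') :
      Set (Submodule.span ℝ (Set.range δ)).topologicalClosure) := by
  rw [closure_subtype]
  have h1 := Submodule.map_span
    (Submodule.span ℝ (Set.range δ)).topologicalClosure.subtype (Set.range δ')
  rw [← Set.range_comp, Submodule.coe_subtype, show _ ∘ δ' = δ from funext h] at h1
  have h2 := congrArg (SetLike.coe : Submodule ℝ D → Set D) h1
  rw [Submodule.map_coe] at h2
  simp only [Submodule.coe_subtype] at h2
  rw [h2]
  exact m.2

theorem LipschitzFree.isFreeEmbedding {M : Type*} [MetricSpace M] (e : M) :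
    IsFreeEmbedding e (LipschitzFree.ofPoint e) where
  base := Subtype.ext LipZero.delta_base
  norm_sub_le x y := LipZero.norm_delta_sub_le x y
  mem_closure_span m := Submodule.mem_closure_span_range_codRestrict (LipZero.delta e) m
    (LipschitzFree.ofPoint e) fun _ => rfl
  linearize φ L W _ hφ h0 hW := by
    obtain ⟨S, hS, hSW, hSφ⟩ := LipZero.exists_linearization hφ h0 W hW
    refine ⟨S.comp (Submodule.subtypeL _), ?_, fun m => hSW m.1, fun x => hSφ x⟩
    exact ContinuousLinearMap.opNorm_le_bound _ L.2 fun m => S.le_of_opNorm_le hS m.1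

namespace IsFreeEmbedding

variable {M : Type*} [MetricSpace M] {e : M} {V : Type*} [NormedAddCommGroup V]
  [NormedSpace ℝ V] {δ : M → V}

/-- An operator of bounded norm is close to the identity at a given vector as soon as it is close
to the identity at suitable finitely many points. -/
theorem exists_finset_forall_norm_sub_le (hδ : IsFreeEmbedding e δ) {l : ℝ} (hl : 0 < l) (m : V) {ε : ℝ}
    (hε : 0 < ε) : ∃ (P : Finset M) (η : ℝ), 0 < η ∧
      ∀ S : V →L[ℝ] V, ‖S‖ ≤ l →
        (∀ p ∈ P, ‖δ p - S (δ p)‖ ≤ η) → ‖m - S m‖ ≤ ε := by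
  classical
  -- The vectors `m - y` and `S (m - y)` together then cost at most `ε / 2`.
  obtain ⟨y, hy, hmy⟩ := Metric.mem_closure_iff.1 (hδ.mem_closure_span m)
    (ε / (2 * (1 + l))) (by positivity)
  have hspan : ∀ ε : ℝ, 0 < ε → ∃ (P : Finset M) (η : ℝ), 0 < η ∧
      ∀ S : V →L[ℝ] V,
        (∀ p ∈ P, ‖δ p - S (δ p)‖ ≤ η) → ‖y - S y‖ ≤ ε := by
    clear hmy
    induction hy using Submodule.span_induction with
    | mem y hy =>
      obtain ⟨x, rfl⟩ := hy
      exact fun ε hε => ⟨{x}, ε, hε, fun S hS => hS x (by simp)⟩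
    | zero => exact fun ε hε => ⟨∅, 1, one_pos, fun S _ => by simpa using hε.le⟩
    | add y z _ _ hy hz =>
      intro ε hε
      obtain ⟨P, η, hη, h⟩ := hy (ε / 2) (by positivity)
      obtain ⟨P', η', hη', h'⟩ := hz (ε / 2) (by positivity)
      refine ⟨P ∪ P', min η η', lt_min hη hη', fun S hS => ?_⟩
      have h1 := h S fun p hp =>
        (hS p (Finset.mem_union_left _ hp)).trans (min_le_left _ _)
      have h2 := h' S fun p hp =>
        (hS p (Finset.mem_union_right _ hp)).trans (min_le_right _ _)
      rw [map_add, add_sub_add_comm]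
      exact (norm_add_le _ _).trans (by linarith)
    | smul a y _ hy =>
      intro ε hε
      obtain ⟨P, η, hη, h⟩ := hy (ε / (|a| + 1)) (by positivity)
      refine ⟨P, η, hη, fun S hS => ?_⟩
      rw [map_smul, ← smul_sub, norm_smul, Real.norm_eq_abs]
      have h1 := (le_div_iff₀ (by positivity)).1 (h S hS)
      nlinarith [norm_nonneg (y - S y)]
  obtain ⟨P, η, hη, h⟩ := hspan (ε / 2) (by positivity)
  refine ⟨P, η, hη, fun S hS hP => ?_⟩
  have h1 := h S hP
  rw [dist_eq_norm] at hmy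
  have h2 : m - S m = (m - y) + (y - S y) - S (m - y) := by rw [map_sub]; abel
  have h3 : ‖S (m - y)‖ ≤ l * ‖m - y‖ := S.le_of_opNorm_le hS _
  have h4 : ‖m - y‖ * (2 * (1 + l)) < ε := (lt_div_iff₀ (by positivity)).1 hmy
  rw [h2]
  have h5 := _root_.norm_sub_le ((m - y) + (y - S y)) (S (m - y))
  have h6 := norm_add_le (m - y) (y - S y)
  linarith

/-- The bounded approximation property of a Lipschitz free space follows from the existence of
Lipschitz maps with finite-dimensional span that approximate the canonical embedding. -/
theorem hasBAP_of_forall_finset (hδ : IsFreeEmbedding e δ) {l : NNReal} (hl : 0 < l)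
    (h : ∀ (P : Finset M) (ε : ℝ), 0 < ε → ∃ (φ : M → V)
      (W : Submodule ℝ (V)), FiniteDimensional ℝ W ∧ (∀ x, φ x ∈ W) ∧
      LipschitzWith l φ ∧ φ e = 0 ∧ ∀ p ∈ P, ‖δ p - φ p‖ ≤ ε) :
    HasBAP l (V) := by
  classical
  refine ⟨hl, fun n x ε hε => ?_⟩
  choose P η hη hP using fun i =>
    hδ.exists_finset_forall_norm_sub_le (NNReal.coe_pos.2 hl) (x i) hε
  obtain ⟨η₀, hη₀, hη₀'⟩ : ∃ η₀ : ℝ, 0 < η₀ ∧ ∀ i, η₀ ≤ η i := by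
    rcases isEmpty_or_nonempty (Fin n) with hn | hn
    · exact ⟨1, one_pos, fun i => isEmptyElim i⟩
    · obtain ⟨i, hi⟩ := Finite.exists_min η
      exact ⟨η i, hη i, hi⟩
  obtain ⟨φ, W, hWfin, hW, hφ, hφ0, hφP⟩ := h (Finset.univ.biUnion P) η₀ hη₀
  obtain ⟨S, hS, hSW, hSφ⟩ := hδ.linearize φ l W hWfin hφ hφ0 hW
  refine ⟨S, ?_, hS, fun i => hP i S hS fun p hp => ?_⟩
  · refine Submodule.finiteDimensional_of_le (S₂ := W) ?_
    rintro _ ⟨m, rfl⟩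
    exact hSW m
  · rw [hSφ]
    exact (hφP p (Finset.mem_biUnion.2 ⟨i, Finset.mem_univ i, hp⟩)).trans (hη₀' i)

end IsFreeEmbedding

/-! ### Approximating the embedding of `K` -/

/-- A convex set containing `0` that spans a finite-dimensional space has nonempty interior. -/
theorem Convex.interior_nonempty_of_span_eq_top {E : Type*} [NormedAddCommGroup E]
    [NormedSpace ℝ E] [FiniteDimensional ℝ E] {C : Set E} (hC : Convex ℝ C) (h0 : (0 : E) ∈ C)
    (h : Submodule.span ℝ C = ⊤) : (interior C).Nonempty := by
  rw [hC.interior_nonempty_iff_affineSpan_eq_top]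
  have h1 := affineSpan_insert_zero (k := ℝ) C
  rw [Set.insert_eq_of_mem h0, h] at h1
  exact SetLike.coe_injective h1

/-- The embedding of a convex set `K` is approximated by Lipschitz maps with finite-dimensional span,
if `K` carries finite-rank operators approximating the identity. -/
theorem IsFreeEmbedding.exists_approx_of_convex {X : Type*} [NormedAddCommGroup X]
    [NormedSpace ℝ X] {K : Set X} (hK : Convex ℝ K) (h0 : (0 : X) ∈ K) {V : Type*}
    [NormedAddCommGroup V] [NormedSpace ℝ V] [CompleteSpace V] {δ : K → V}
    (hδ : IsFreeEmbedding ⟨0, h0⟩ δ) {l : NNReal} {T : ℕ → X →L[ℝ] X}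
    (hT_finite : ∀ n, FiniteDimensional ℝ (T n).range) (hT_norm : ∀ n, ‖T n‖ ≤ l)
    (hT_maps : ∀ n, Set.MapsTo (T n) K K)
    (hT_tendsto : ∀ x ∈ K, Filter.Tendsto (fun n => T n x) Filter.atTop (nhds x))
    (P : Finset K) {ε : ℝ} (hε : 0 < ε) :
    ∃ (φ : K → V) (W : Submodule ℝ V), FiniteDimensional ℝ W ∧ (∀ x, φ x ∈ W) ∧
      LipschitzWith l φ ∧ φ ⟨0, h0⟩ = 0 ∧ ∀ p ∈ P, ‖δ p - φ p‖ ≤ ε := by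
  obtain ⟨B, hB, hPB⟩ : ∃ B : ℝ, 0 < B ∧ ∀ p ∈ P, ‖(p : X)‖ ≤ B := by
    refine ⟨1 + ∑ p ∈ P, ‖(p : X)‖, by positivity, fun p hp => ?_⟩
    have := Finset.single_le_sum (f := fun q : K => ‖(q : X)‖) (fun q _ => norm_nonneg (q : X)) hp
    linarith
  set η := ε / (4 * B ^ 2) with hη_def
  have hη : 0 < η := by positivity
  -- Radial projection onto a ball may have Lipschitz constant 2 in a general normed space, which
  -- would spoil `λ`. This map is nonexpansive and moves `x` by at most `η * ‖x‖ ^ 2`, whence the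
  -- choice of `η`.
  set ρ : X → X := fun x => (1 + η * ‖x‖)⁻¹ • x with hρ_def
  have hρK {x : X} (hx : x ∈ K) : ρ x ∈ K :=
    hK.smul_mem_of_zero_mem h0 hx ⟨by positivity,
      inv_le_one_of_one_le₀ (by linarith [mul_nonneg hη.le (norm_nonneg x)])⟩
  have hρ_lip (x y : X) : ‖ρ x - ρ y‖ ≤ ‖x - y‖ := norm_inv_one_add_smul_sub_le hη x y
  have hρ_bd (x : X) : ‖ρ x‖ ≤ η⁻¹ := by
    rw [hρ_def]
    simp only
    rw [norm_smul, Real.norm_of_nonneg (by positivity), inv_mul_le_iff₀ (by positivity), add_mul,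
      mul_right_comm, mul_inv_cancel₀ hη.ne']
    linarith [inv_pos.2 hη]
  have hρ_near (x : X) (hx : ‖x‖ ≤ B) : ‖ρ x - x‖ ≤ ε / 4 := by
    have h1 : ρ x - x = -((η * ‖x‖ * (1 + η * ‖x‖)⁻¹) • x) := by
      have h2 : η * ‖x‖ * (1 + η * ‖x‖)⁻¹ = 1 - (1 + η * ‖x‖)⁻¹ := by
        field_simp; ring
      rw [h2, sub_smul, one_smul, neg_sub]
    rw [h1, norm_neg, norm_smul, Real.norm_of_nonneg (by positivity)]
    have h4 : (1 + η * ‖x‖)⁻¹ ≤ 1 :=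
      inv_le_one_of_one_le₀ (by linarith [mul_nonneg hη.le (norm_nonneg x)])
    calc η * ‖x‖ * (1 + η * ‖x‖)⁻¹ * ‖x‖ ≤ η * B * 1 * B := by gcongr
      _ = ε / 4 := by rw [hη_def]; field_simp
  obtain ⟨n, hn⟩ : ∃ n, ∀ p ∈ P, ‖T n (ρ p) - ρ p‖ ≤ ε / 4 := by
    have h1 : ∀ p ∈ P, ∀ᶠ n in Filter.atTop, ‖T n (ρ p) - ρ p‖ ≤ ε / 4 := fun p _ => by
      filter_upwards [Metric.tendsto_nhds.1 (hT_tendsto _ (hρK p.2)) (ε / 4) (by positivity)]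
        with n hn
      rw [← dist_eq_norm]
      exact hn.le
    exact ((Finset.eventually_all P).2 h1).exists
  set s : Set X := K ∩ (T n).range ∩ Metric.closedBall 0 (l * η⁻¹) with hs_def
  have hs_conv : Convex ℝ s :=
    (hK.inter (Submodule.convex _)).inter (convex_closedBall _ _)
  have hs0 : (0 : X) ∈ s := ⟨⟨h0, zero_mem _⟩, Metric.mem_closedBall_self (by positivity)⟩
  have hTs (x : K) : T n (ρ x) ∈ s := by
    refine ⟨⟨hT_maps n (hρK x.2), ⟨ρ x, rfl⟩⟩, ?_⟩
    rw [mem_closedBall_zero_iff]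
    exact ((T n).le_of_opNorm_le (hT_norm n) _).trans (by gcongr; exact hρ_bd x)
  -- The span of `s`, rather than the whole range of `T n`, makes `s` a body with interior points.
  let E : Submodule ℝ X := Submodule.span ℝ s
  have : FiniteDimensional ℝ E := by
    have := hT_finite n
    exact Submodule.finiteDimensional_of_le (S₂ := (T n).range)
      (Submodule.span_le.2 fun x hx => hx.1.2)
  let C : Set E := E.subtype ⁻¹' s
  have hC0 : (0 : E) ∈ C := hs0
  have hC_conv : Convex ℝ C := hs_conv.linear_preimage E.subtype
  have hC_int : (interior C).Nonempty :=
    hC_conv.interior_nonempty_of_span_eq_top hC0 Submodule.span_span_coe_preimage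
  have hC_bd : Bornology.IsBounded C := by
    refine (Metric.isBounded_closedBall (x := (0 : E)) (r := l * η⁻¹)).subset fun x hx => ?_
    have h1 : (x : X) ∈ Metric.closedBall 0 (l * η⁻¹) := hx.2
    simpa using h1
  classical
  -- The value 0 is immaterial, since points of `C` lie in `K`.
  let f : E → V := fun x => if h : (x : X) ∈ K then δ ⟨x, h⟩ else 0
  have hfC {x : E} (hx : (x : X) ∈ K) : f x = δ ⟨x, hx⟩ := dif_pos hx
  have hf : ∀ x ∈ C, ∀ y ∈ C, ‖f x - f y‖ ≤ ‖x - y‖ := fun x hx y hy => by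
    rw [hfC hx.1.1, hfC hy.1.1]
    refine (hδ.norm_sub_le _ _).trans_eq ?_
    rw [Subtype.dist_eq, dist_eq_norm]
    rfl
  obtain ⟨g, W, hWfin, hgW, hg_lip, hg_near⟩ :=
    exists_finiteDimensional_nonexpansive_near hC_conv hC_bd hC_int hf
      (by positivity : 0 < ε / 4)
  let τ : K → E := fun x => ⟨T n (ρ x), Submodule.subset_span (hTs x)⟩
  have hτC (x : K) : τ x ∈ C := hTs x
  -- Subtracting `g 0` restores the base point. The error is `ε / 4` each for `ρ`, `T n`, `g` at `τ
  -- p`, and `g 0`.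
  refine ⟨fun x => g (τ x) - g 0, W, hWfin, fun x => W.sub_mem (hgW _ (hτC x)) (hgW _ hC0),
    LipschitzWith.of_dist_le_mul fun x y => ?_, ?_, fun p hp => ?_⟩
  · rw [dist_sub_right, dist_eq_norm]
    calc ‖g (τ x) - g (τ y)‖ ≤ ‖τ x - τ y‖ := hg_lip _ (hτC x) _ (hτC y)
      _ = ‖T n (ρ x - ρ y)‖ := by rw [map_sub]; rfl
      _ ≤ l * ‖ρ x - ρ y‖ := (T n).le_of_opNorm_le (hT_norm n) _
      _ ≤ l * dist x y := by
          rw [Subtype.dist_eq, dist_eq_norm]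
          gcongr
          exact hρ_lip x y
  · have : τ ⟨0, h0⟩ = 0 := Subtype.ext (by simp [τ, hρ_def])
    simp [this]
  · have h1 := hg_near _ (hτC p)
    have h2 := hg_near _ hC0
    rw [hfC (x := 0) h0] at h2
    rw [hfC (hτC p).1.1] at h1
    have h3 := hδ.norm_sub_le p ⟨τ p, (hτC p).1.1⟩
    have h4 : dist p ⟨τ p, (hτC p).1.1⟩ ≤ ε / 2 := by
      rw [Subtype.dist_eq, dist_comm]
      refine (dist_triangle _ (ρ p) _).trans ?_
      rw [dist_eq_norm, dist_eq_norm]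
      linarith [hn p hp, hρ_near p (hPB p hp)]
    have h5 : δ ⟨((0 : E) : X), h0⟩ = 0 := hδ.base
    rw [h5, sub_zero] at h2
    have h6 : δ p - (g (τ p) - g 0) = (δ p - δ ⟨τ p, (hτC p).1.1⟩) -
        (g (τ p) - δ ⟨τ p, (hτC p).1.1⟩) + g 0 := by abel
    rw [h6]
    have h7 := norm_add_le ((δ p - δ ⟨τ p, (hτC p).1.1⟩) -
        (g (τ p) - δ ⟨τ p, (hτC p).1.1⟩)) (g 0)
    have h8 := _root_.norm_sub_le (δ p - δ ⟨τ p, (hτC p).1.1⟩) (g (τ p) - δ ⟨τ p, (hτC p).1.1⟩)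
    linarith

theorem proposition2 {X : Type*} [NormedAddCommGroup X] [NormedSpace ℝ X] [CompleteSpace X]
    (K : Set X) (hK_closed : IsClosed K) (hK_convex : Convex ℝ K) (h0 : (0 : X) ∈ K)
    (l : ℝ) (hl : 1 ≤ l) (T : ℕ → X →L[ℝ] X)
    (hT_finite : ∀ n, FiniteDimensional ℝ (T n).range)
    (hT_norm : ∀ n, ‖T n‖ ≤ l)
    (hT_maps : ∀ n, Set.MapsTo (T n) K K)
    (hT_tendsto : ∀ x ∈ K, Filter.Tendsto (fun n => T n x) Filter.atTop (nhds x)) :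
    HasBAP l (LipschitzFree K ⟨0, h0⟩) := by
  lift l to NNReal using by linarith
  have hl0 : 0 < l := zero_lt_one.trans_le hl
  have hδ := LipschitzFree.isFreeEmbedding (⟨0, h0⟩ : K)
  exact hδ.hasBAP_of_forall_finset hl0 fun P ε hε =>
    hδ.exists_approx_of_convex hK_convex h0 hT_finite hT_norm hT_maps hT_tendsto P hε
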